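/- Setting (the Fitzsimons–Kashefi (FK) protocol). Let $\widetilde K_{3N}$ be the dotted-complete graph: the complete graph on $3N$ (primary) vertices in which every edge is replaced by a new (dotted) vertex joined to the two endpoints of that edge. Its vertices label the qubits. The verifier splits the primary vertices, by a uniformly random hidden partition, into three labelled groups of $N$. Group $0$, together with the dotted vertices on those of its pairs that are edges of the computation graph $\mathcal G$, carries an arbitrary adaptive measurement-based computation; the primary vertices of group $1$ and the dotted vertices joining two vertices of group $2$ are traps; all other vertices are dummies. The verifier sends the ideal input $\Psi^\nu=\bigotimes_w \pi_w$, where $\nu$ denotes all his secret uniformly random choices: $\pi_w=|d_w\rangle\langle d_w|$, $d_w\in\{0,1\}$, for dummies, and $\pi_w=|+_{\theta_w}\rangle\langle +_{\theta_w}|$, $\theta_w\in\{0,\pi/4,\dots,7\pi/4\}$, otherwise. The prover applies controlled-$Z$ along all edges of $\widetilde K_{3N}$ and measures each qubit $w$ in the basis $|\pm_{\delta_w}\rangle$, where $\delta_w=\theta_w+\phi'_w+r_w\pi$ is sent by the verifier, $r_w\in\{0,1\}$ is random, and the adapted angle $\phi'_w$ includes the $Z$-correction $\pi\cdot\#\{\text{dummy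 neighbours } u \text{ of } w \text{ with } d_u=1\}$; traps have computation angle $a_t\pi$ with $a_t\in\{0,1\}$ random. The verifier accepts iff every trap $t$ gives its expected outcome $b_t=r_t\oplus a_t$. Let $\mathcal R\Psi^\nu=\bigotimes_w R(\pi_w)$ be the reflection of the ideal input about the $XY$-plane, where $R$ maps the qubit state with Bloch vector $(x,y,z)$ to the one with Bloch vector $(x,y,-z)$ (so exactly the dummies are flipped). Lemma. There is an absolute constant $K>0$ such that the following holds for every $N$ and every computation. Assume that, for every partition, some trap has an odd number of dummy neighbours, and that the prover carries out the steps above. Then on the input $\mathcal R\Psi^\nu$ the verifier rejects with probability $1$, for every $\nu$. Moreover, if for every $\nu$ the input is a density operator $\rho^\nu$ on the same qubits with $\tfrac12\|\rho^\nu-\mathcal R\Psi^\nu\|_1\le\varepsilon$, then the verifier rejects with probability at least $1-K\sqrt{\varepsilon}$, both for every fixed $\nu$ and on average over $\nu$. -/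

import Mathlib

open scoped ComplexOrder

noncomputable section

namespace FK

/-! ### Dotted graphs -/

/-- Vertices of the dotted graph of `G`: the vertices of `G` (primary vertices), and one new
(dotted) vertex for every edge of `G`. -/
abbrev DottedVertex {W : Type} (G : SimpleGraph W) : Type := W ⊕ G.edgeSet

/-- The dotted graph of `G`: every edge of `G` is replaced by a new vertex joined to the two
endpoints of that edge. -/
def dotted {W : Type} (G : SimpleGraph W) : SimpleGraph (DottedVertex G) where
  Adj
    | Sum.inl v, Sum.inr e => v ∈ e.1
    | Sum.inr e, Sum.inl v => v ∈ e.1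
    | _, _ => False
  symm := ⟨by rintro (v | e) (w | f) h <;> exact h⟩
  loopless := ⟨by rintro (v | e) h <;> exact h⟩

/-- Vertices of the dotted-complete graph on `3N` primary vertices; the qubits of the protocol are
indexed by this type. -/
abbrev Qubit (N : ℕ) : Type := DottedVertex (⊤ : SimpleGraph (Fin (3 * N)))

/-! ### Qubits, states and distances -/

/-- Operators on the qubits labelled by `V`, in the computational basis. -/
abbrev Op (V : Type) : Type := Matrix (V → Fin 2) (V → Fin 2) ℂ

/-- Tensor product of single-qubit operators. -/
def tensor {V : Type} [Fintype V] (A : V → Matrix (Fin 2) (Fin 2) ℂ) : Op V :=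
  Matrix.of fun x y => ∏ v, A v (x v) (y v)

/-- `|ψ⟩⟨ψ|`. -/
def proj (ψ : Fin 2 → ℂ) : Matrix (Fin 2) (Fin 2) ℂ := Matrix.vecMulVec ψ (star ψ)

/-- `|+_θ⟩ = (|0⟩ + e^{iθ}|1⟩)/√2`. Angles are the multiples of `π/4`: the element `θ` of `ZMod 8`
stands for the angle `θ * π / 4`. -/
def plusKet (θ : ZMod 8) : Fin 2 → ℂ :=
  ![1 / (Real.sqrt 2 : ℂ),
    Complex.exp (Complex.I * ((θ.val : ℂ) * (Real.pi : ℂ) / 4)) / (Real.sqrt 2 : ℂ)]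

/-- The computational basis state `|d⟩`. -/
def basisKet (d : Fin 2) : Fin 2 → ℂ := Pi.single d 1

/-- The angle `b * π`. -/
def piTimes (b : Fin 2) : ZMod 8 := 4 * (b.val : ZMod 8)

def pauliX : Matrix (Fin 2) (Fin 2) ℂ := !![0, 1; 1, 0]
def pauliY : Matrix (Fin 2) (Fin 2) ℂ := !![0, -Complex.I; Complex.I, 0]
def pauliZ : Matrix (Fin 2) (Fin 2) ℂ := !![1, 0; 0, -1]

/-- Reflection of a one-qubit state about the `XY`-plane of the Bloch ball: the Bloch vector
`(x, y, z)` becomes `(x, y, -z)`. -/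
def reflectXY (A : Matrix (Fin 2) (Fin 2) ℂ) : Matrix (Fin 2) (Fin 2) ℂ :=
  (1 / 2 : ℂ) • (A.trace • (1 : Matrix (Fin 2) (Fin 2) ℂ) + (pauliX * A).trace • pauliX
    + (pauliY * A).trace • pauliY - (pauliZ * A).trace • pauliZ)

/-- Density operators. -/
def IsDensity {V : Type} [Fintype V] [DecidableEq V] (ρ : Op V) : Prop := ρ.PosSemidef ∧ ρ.trace = 1

/-- The trace norm: the sum of the singular values. -/
def traceNorm {n : Type} [Fintype n] [DecidableEq n] (A : Matrix n n ℂ) : ℝ :=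
  ∑ i, Real.sqrt ((Matrix.isHermitian_conjTranspose_mul_self A).eigenvalues i)

/-- The trace distance. -/
def traceDist {n : Type} [Fintype n] [DecidableEq n] (A B : Matrix n n ℂ) : ℝ :=
  traceNorm (A - B) / 2

open Classical in
/-- The product of the controlled-`Z` gates over all edges of a graph. -/
def entangle {V : Type} [Fintype V] (G : SimpleGraph V) : Op V :=
  Matrix.diagonal fun x => ∏ e ∈ G.edgeFinset, if ∀ v ∈ e, x v = 1 then (-1 : ℂ) else 1

/-! ### The protocol -/

/-- A delegated measurement-based computation: an (encoded) graph on `N` vertices whose dotted graph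
carries the computation, the computation angles, the order in which the computation qubits are
measured, and the rules for the `X`- and `Z`-corrections of a measurement, which depend on the
(decoded) outcomes of earlier measurements only. -/
structure Computation (N : ℕ) where
  graph : SimpleGraph (Fin N)
  angle : DottedVertex graph → ZMod 8
  step : DottedVertex graph → ℕ
  xCorr : DottedVertex graph → (DottedVertex graph → Fin 2) → Fin 2
  zCorr : DottedVertex graph → (DottedVertex graph → Fin 2) → Fin 2
  xCorr_causal : ∀ i s s', (∀ j, step j < step i → s j = s' j) → xCorr i s = xCorr i s'
  zCorr_causal : ∀ i s s', (∀ j, step j < step i → s j = s' j) → zCorr i s = zCorr i s'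

/-- The hidden partition of the primary vertices into three groups of `N`: group `0` carries the
computation, group `1` the traps on primary vertices, group `2` surrounds the traps on dotted
vertices. -/
abbrev Layout (N : ℕ) : Type := Fin (3 * N) ≃ Fin 3 × Fin N

/-- The verifier's secret random choices: the layout, the rotations `θ`, the bits `r` hiding the
outcomes, the values `d` of the dummies, and the trap angles `a * π`. (Only the entries of `d` at
dummies and of `a` at traps are used.) -/
structure Secret (N : ℕ) where
  layout : Layout N
  θ : Qubit N → ZMod 8
  r : Qubit N → Fin 2
  d : Qubit N → Fin 2
  a : Qubit N → Fin 2

instance (N : ℕ) : Fintype (Secret N) :=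
  Fintype.ofEquiv
    (Layout N × (Qubit N → ZMod 8) × (Qubit N → Fin 2) × (Qubit N → Fin 2) × (Qubit N → Fin 2))
    { toFun := fun p => ⟨p.1, p.2.1, p.2.2.1, p.2.2.2.1, p.2.2.2.2⟩
      invFun := fun ν => (ν.layout, ν.θ, ν.r, ν.d, ν.a)
      left_inv := fun _ => rfl
      right_inv := fun _ => rfl }

variable {N : ℕ}

/-- The computation graph sits on group `0`. -/
def graphHom (C : Computation N) (σ : Layout N) :
    C.graph →g (⊤ : SimpleGraph (Fin (3 * N))) where
  toFun i := σ.symm (0, i)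
  map_rel' {i j} h := by
    rw [SimpleGraph.top_adj]
    intro h'
    exact h.ne (Prod.ext_iff.1 (σ.symm.injective h')).2

/-- The position of a computation qubit among all qubits. -/
def place (C : Computation N) (σ : Layout N) : DottedVertex C.graph → Qubit N :=
  Sum.map (graphHom C σ) (graphHom C σ).mapEdgeSet

def IsComputation (C : Computation N) (σ : Layout N) (w : Qubit N) : Prop :=
  ∃ c, place C σ c = w

/-- Traps: the primary vertices of group `1`, and the dotted vertices inside group `2`. -/
def IsTrap (σ : Layout N) : Qubit N → Prop
  | Sum.inl v => (σ v).1 = 1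
  | Sum.inr e => ∀ v ∈ e.1, (σ v).1 = 2

/-- All other qubits are dummies. -/
def IsDummy (C : Computation N) (σ : Layout N) (w : Qubit N) : Prop :=
  ¬ IsComputation C σ w ∧ ¬ IsTrap σ w

/-- The dummy neighbours of a qubit in the dotted-complete graph. -/
def dummyNeighbors (C : Computation N) (σ : Layout N) (w : Qubit N) : Set (Qubit N) :=
  {u | (dotted (⊤ : SimpleGraph (Fin (3 * N)))).Adj w u ∧ IsDummy C σ u}

/-- Some trap has an odd number of dummy neighbours. -/
def HasOddTrap (C : Computation N) (σ : Layout N) : Prop :=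
  ∃ t, IsTrap σ t ∧ Odd (dummyNeighbors C σ t).ncard

open Classical in
/-- The pure state of each qubit that the verifier intends to send: `|d⟩` for dummies, `|+_θ⟩` for
computation and trap qubits. -/
def idealKet (C : Computation N) (ν : Secret N) (w : Qubit N) : Fin 2 → ℂ :=
  if IsDummy C ν.layout w then basisKet (ν.d w) else plusKet (ν.θ w)

/-- The ideal input state. -/
def idealInput (C : Computation N) (ν : Secret N) : Op (Qubit N) :=
  tensor fun w => proj (idealKet C ν w)

/-- The reflection of the ideal input about the `XY`-plane. -/
def reflectedInput (C : Computation N) (ν : Secret N) : Op (Qubit N) :=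
  tensor fun w => reflectXY (proj (idealKet C ν w))

/-- The angle of a computation qubit, adapted to the decoded outcomes `s` of the computation
qubits: `(-1)^{s_X} φ + s_Z π`. -/
def adaptedAngle (C : Computation N) (s : DottedVertex C.graph → Fin 2)
    (i : DottedVertex C.graph) : ZMod 8 :=
  (if C.xCorr i s = 1 then - C.angle i else C.angle i) + piTimes (C.zCorr i s)

open Classical in
/-- The adapted angle `φ'` of a qubit, before accounting for dummy neighbours, when `b` is the list
of reported outcomes: the adapted computation angle for computation qubits, `0` or `π` for traps,
`0` for dummies. The outcome `b` of a qubit is decoded to `b + r`. -/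
def baseAngle (C : Computation N) (ν : Secret N) (b : Qubit N → Fin 2) : Qubit N → ZMod 8 :=
  Function.extend (place C ν.layout)
    (adaptedAngle C fun c => b (place C ν.layout c) + ν.r (place C ν.layout c))
    (fun w => if IsTrap ν.layout w then piTimes (ν.a w) else 0)

/-- The number of neighbours of a qubit which the verifier meant to be dummies in state `|1⟩`; each
of them makes the verifier expect a `Z` on that qubit. -/
def oneNeighbors (C : Computation N) (ν : Secret N) (w : Qubit N) : ℕ :=
  {u ∈ dummyNeighbors C ν.layout w | ν.d u = 1}.ncard

/-- The measurement angle `δ = θ + φ' + r π` which the verifier sends. -/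
def measAngle (C : Computation N) (ν : Secret N) (b : Qubit N → Fin 2) (w : Qubit N) : ZMod 8 :=
  ν.θ w + (baseAngle C ν b w + 4 * (oneNeighbors C ν w : ZMod 8)) + piTimes (ν.r w)

/-- The probability that the outcomes `b` are reported when the prover receives the state `ρ` and
follows the protocol: he applies the controlled-`Z` gates of the dotted-complete graph and measures
each qubit `w` in the basis `|+_δ⟩` (outcome `0`), `|-_δ⟩ = |+_{δ+π}⟩` (outcome `1`), with the
adaptive angles `δ` sent by the verifier. -/
def outcomeProb (C : Computation N) (ν : Secret N) (ρ : Op (Qubit N)) (b : Qubit N → Fin 2) : ℝ :=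
  let E : Op (Qubit N) := entangle (dotted (⊤ : SimpleGraph (Fin (3 * N))))
  (((tensor fun w => proj (plusKet (measAngle C ν b w + piTimes (b w))))
    * (E * ρ * E.conjTranspose)).trace).re

/-- The verifier accepts if every trap gives its expected outcome. -/
def Accepts (ν : Secret N) (b : Qubit N → Fin 2) : Prop :=
  ∀ t, IsTrap ν.layout t → b t = ν.r t + ν.a t

open Classical in
/-- The probability that the verifier rejects, for given secret choices. -/
def rejectProb (C : Computation N) (ν : Secret N) (ρ : Op (Qubit N)) : ℝ :=
  ∑ b : Qubit N → Fin 2, if Accepts ν b then 0 else outcomeProb C ν ρ b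

/-- The probability that the protocol rejects: the secret choices are uniformly random, and `ρ ν` is
the input state sent for the choices `ν`. -/
def protocolRejectProb (C : Computation N) (ρ : Secret N → Op (Qubit N)) : ℝ :=
  (∑ ν, rejectProb C ν (ρ ν)) / (Fintype.card (Secret N) : ℝ)

end FK

end

/-
All neighbours of a trap are dummies, so they are in basis states, and the controlled-`Z` gates just
apply to the trap one `Z` for each neighbour in state `|1⟩`. If the trap has an odd number of dummy
neighbours, flipping all dummies changes the number of these `Z`s by an odd number, and the trap
ends up in the state orthogonal to the one the verifier expects.

For an arbitrary input, the adaptive measurement is still a measurement in an orthonormal basis: of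
the qubits on which two lists of outcomes differ, the first is measured at the same angle for both.
Hence the rejection probabilities of two inputs differ by at most their trace distance. This bound
is linear in `ε`, and implies the one with `√ε` because probabilities are nonnegative.
-/

noncomputable section

namespace FK

open scoped Finset Matrix

theorem sum_eq_zero_of_add_update {V M : Type*} [Fintype V] [DecidableEq V]
    [AddCommMonoid M] (t : V) {f : (V → Fin 2) → M}
    (hf : ∀ x, x t = 0 → f x + f (Function.update x t 1) = 0) : ∑ x, f x = 0 := by
  rw [← (Equiv.funSplitAt t (Fin 2)).symm.sum_comp, Fintype.sum_prod_type, Fin.sum_univ_two,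
    ← Finset.sum_add_distrib]
  refine Finset.sum_eq_zero fun y _ => ?_
  convert hf ((Equiv.funSplitAt t (Fin 2)).symm (0, y)) (by simp) using 3
  ext v
  by_cases hv : v = t <;> simp [hv]

section Conjugation

variable {n R : Type*} [Fintype n] [CommRing R] [StarRing R]

theorem trace_vecMulVec_star_mul (v : n → R) (X : Matrix n n R) :
    (Matrix.vecMulVec v (star v) * X).trace = star v ⬝ᵥ (X *ᵥ v) := by
  rw [Matrix.vecMulVec_mul, Matrix.trace_vecMulVec, dotProduct_comm, Matrix.dotProduct_mulVec]

theorem mul_mul_conjTranspose_apply {m : Type*} (M : Matrix m n R) (X : Matrix n n R)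
    (i j : m) : (M * X * Mᴴ) i j = M i ⬝ᵥ (X *ᵥ star (M j)) := by
  rw [Matrix.mul_assoc, Matrix.mul_apply']
  rfl

theorem trace_mul_mul_conjTranspose [DecidableEq n] {U : Matrix n n R}
    (hU : U ∈ Matrix.unitaryGroup n R) (A : Matrix n n R) : (U * A * Uᴴ).trace = A.trace := by
  rw [Matrix.trace_mul_comm, ← mul_assoc, ← Matrix.star_eq_conjTranspose,
    Matrix.mem_unitaryGroup_iff'.1 hU, one_mul]

end Conjugation

section TraceNorm

open scoped Matrix.Norms.L2Operator

variable {n : Type} [Fintype n] [DecidableEq n]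

theorem norm_toEuclideanLin_eigenvectorBasis (A : Matrix n n ℂ) (i : n) :
    ‖A.toEuclideanLin ((Matrix.isHermitian_conjTranspose_mul_self A).eigenvectorBasis i)‖ =
      Real.sqrt ((Matrix.isHermitian_conjTranspose_mul_self A).eigenvalues i) := by
  rw [Matrix.IsHermitian.eigenvalues_eq, ← Matrix.mulVec_mulVec, Matrix.dotProduct_mulVec,
    ← Matrix.star_mulVec, dotProduct_comm, norm_eq_sqrt_re_inner (𝕜 := ℂ),
    EuclideanSpace.inner_eq_star_dotProduct]
  rfl

theorem norm_trace_mul_le (M A : Matrix n n ℂ) : ‖(M * A).trace‖ ≤ ‖M‖ * traceNorm A := by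
  let v := (Matrix.isHermitian_conjTranspose_mul_self A).eigenvectorBasis
  have htrace : (M * A).trace = ∑ i, inner ℂ (v i) ((M * A).toEuclideanLin (v i)) := by
    rw [← LinearMap.trace_eq_sum_inner, Matrix.toEuclideanLin, Matrix.toLpLin_eq_toLin,
      Matrix.trace_toLin_eq]
  rw [htrace, traceNorm, Finset.mul_sum]
  refine (norm_sum_le _ _).trans (Finset.sum_le_sum fun i _ => ?_)
  calc ‖inner ℂ (v i) ((M * A).toEuclideanLin (v i))‖
      ≤ ‖(M * A).toEuclideanLin (v i)‖ := by
        simpa [v.orthonormal.1 i] using norm_inner_le_norm (𝕜 := ℂ) (v i) _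
    _ = ‖M.toEuclideanLin (A.toEuclideanLin (v i))‖ := by
        rw [Matrix.toLpLin_mul_same]; rfl
    _ ≤ ‖M‖ * ‖A.toEuclideanLin (v i)‖ := Matrix.l2_opNorm_mulVec M _
    _ = ‖M‖ * _ := by rw [norm_toEuclideanLin_eigenvectorBasis]

theorem norm_sum_diag_conj_le {U A : Matrix n n ℂ} (hU : U ∈ Matrix.unitaryGroup n ℂ)
    (hA : A.trace = 0) (s : Finset n) :
    ‖∑ i ∈ s, (U * A * Uᴴ) i i‖ ≤ traceNorm A / 2 := by
  -- `A` has trace zero, so twice the weights `1, 0` amounts to the weights `1, -1` of a unitary.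
  set D : Matrix n n ℂ := Matrix.diagonal fun i => if i ∈ s then 1 else -1
  have hD : ‖Uᴴ * D * U‖ ≤ 1 := by
    rw [← Matrix.star_eq_conjTranspose, CStarRing.norm_mul_mem_unitary _ hU,
      CStarRing.norm_mem_unitary_mul _ (Unitary.star_mem hU), Matrix.l2_opNorm_diagonal,
      pi_norm_le_iff_of_nonneg zero_le_one]
    intro i
    split_ifs <;> simp
  have htwo : 2 * ∑ i ∈ s, (U * A * Uᴴ) i i = (Uᴴ * D * U * A).trace :=
    calc 2 * ∑ i ∈ s, (U * A * Uᴴ) i i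
        = 2 * ∑ i ∈ s, (U * A * Uᴴ) i i - (U * A * Uᴴ).trace := by
          rw [trace_mul_mul_conjTranspose hU, hA, sub_zero]
      _ = ∑ i, (2 * (if i ∈ s then (U * A * Uᴴ) i i else 0) - (U * A * Uᴴ) i i) := by
          rw [Finset.sum_sub_distrib, ← Finset.mul_sum, Finset.sum_ite_mem, Finset.univ_inter]
          rfl
      _ = (D * (U * A * Uᴴ)).trace := by
          refine Finset.sum_congr rfl fun i _ => ?_
          rw [Matrix.diag_apply, Matrix.diagonal_mul]
          split_ifs <;> ring
      _ = (Uᴴ * D * U * A).trace := by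
          rw [← mul_assoc, Matrix.trace_mul_comm, ← mul_assoc, ← mul_assoc]
  have hnorm := (norm_trace_mul_le (Uᴴ * D * U) A).trans
    (mul_le_of_le_one_left (Finset.sum_nonneg fun _ _ => Real.sqrt_nonneg _) hD)
  rw [← htwo, norm_mul, Complex.norm_ofNat] at hnorm
  linarith

end TraceNorm

section Qubit

theorem plusKet_eq_smul (θ : ZMod 8) :
    plusKet θ = (Real.sqrt 2 : ℂ)⁻¹ • ![1, ZMod.stdAddChar θ] := by
  have hphase : ZMod.stdAddChar θ =
      Complex.exp (Complex.I * ((θ.val : ℂ) * (Real.pi : ℂ) / 4)) := by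
    rw [ZMod.stdAddChar_apply, ZMod.toCircle_apply]
    congr 1
    push_cast
    ring
  rw [plusKet, hphase]
  ext k
  fin_cases k <;> simp [div_eq_inv_mul]

theorem stdAddChar_four : ZMod.stdAddChar (4 : ZMod 8) = -1 := by
  rw [show (4 : ZMod 8) = ((4 : ℤ) : ZMod 8) from rfl, ZMod.stdAddChar_coe,
    ← Complex.exp_pi_mul_I]
  congr 1
  push_cast
  ring

theorem star_plusKet_dotProduct_plusKet (θ η : ZMod 8) :
    star (plusKet θ) ⬝ᵥ plusKet η = (1 + ZMod.stdAddChar (η - θ)) / 2 := by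
  have hsqrt : ((Real.sqrt 2 : ℂ)⁻¹) * (Real.sqrt 2 : ℂ)⁻¹ = 1 / 2 := by
    rw [← mul_inv, ← Complex.ofReal_mul, Real.mul_self_sqrt zero_le_two]
    norm_num
  calc star (plusKet θ) ⬝ᵥ plusKet η
      = (Real.sqrt 2 : ℂ)⁻¹ * (Real.sqrt 2 : ℂ)⁻¹ *
          (1 + ZMod.stdAddChar η * starRingEnd ℂ (ZMod.stdAddChar θ)) := by
        simp [plusKet_eq_smul, dotProduct, Fin.sum_univ_two]
        ring
    _ = (1 + ZMod.stdAddChar (η - θ)) / 2 := by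
        rw [hsqrt, sub_eq_add_neg, AddChar.map_add_eq_mul, AddChar.map_neg_eq_conj]
        ring

theorem star_plusKet_dotProduct_self (θ : ZMod 8) : star (plusKet θ) ⬝ᵥ plusKet θ = 1 := by
  rw [star_plusKet_dotProduct_plusKet, sub_self, AddChar.map_zero_eq_one]
  norm_num

theorem star_plusKet_dotProduct_add_four (θ : ZMod 8) :
    star (plusKet θ) ⬝ᵥ plusKet (θ + 4) = 0 := by
  rw [star_plusKet_dotProduct_plusKet, add_sub_cancel_left, stdAddChar_four]
  norm_num

theorem star_basisKet_dotProduct_self (d : Fin 2) : star (basisKet d) ⬝ᵥ basisKet d = 1 := by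
  simp [basisKet]

theorem piTimes_eq_add_four_of_ne {b c : Fin 2} (h : b ≠ c) : piTimes c = piTimes b + 4 := by
  revert b c
  decide

theorem pauliZ_pow_mulVec (k : ℕ) (ψ : Fin 2 → ℂ) :
    pauliZ ^ k *ᵥ ψ = ![ψ 0, (-1) ^ k * ψ 1] := by
  have hdiag : pauliZ = Matrix.diagonal ![1, -1] := by
    ext i j
    fin_cases i <;> fin_cases j <;> rfl
  rw [hdiag, Matrix.diagonal_pow]
  ext i
  fin_cases i <;> simp [Matrix.mulVec_diagonal]

theorem pauliZ_pow_mulVec_plusKet (k : ℕ) (θ : ZMod 8) :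
    pauliZ ^ k *ᵥ plusKet θ = plusKet (θ + 4 * k) := by
  have hphase : ZMod.stdAddChar (4 * (k : ZMod 8)) = (-1) ^ k := by
    rw [mul_comm, ← nsmul_eq_mul, AddChar.map_nsmul_eq_pow, stdAddChar_four]
  rw [pauliZ_pow_mulVec, plusKet_eq_smul, plusKet_eq_smul, AddChar.map_add_eq_mul, hphase]
  ext i
  fin_cases i
  · rfl
  · simp
    ring

theorem trace_proj (ψ : Fin 2 → ℂ) : (proj ψ).trace = star ψ ⬝ᵥ ψ := by
  rw [proj, Matrix.trace_vecMulVec, dotProduct_comm]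

theorem reflectXY_eq (A : Matrix (Fin 2) (Fin 2) ℂ) :
    reflectXY A = !![A 1 1, A 0 1; A 1 0, A 0 0] := by
  obtain ⟨a, b, c, d, rfl⟩ : ∃ a b c d, A = !![a, b; c, d] := ⟨_, _, _, _, A.eta_fin_two⟩
  ext i j
  fin_cases i <;> fin_cases j <;>
    simp [reflectXY, pauliX, pauliY, pauliZ, Matrix.trace_fin_two] <;> grind [Complex.I_mul_I]

theorem trace_reflectXY (A : Matrix (Fin 2) (Fin 2) ℂ) : (reflectXY A).trace = A.trace := by
  rw [reflectXY_eq, Matrix.trace_fin_two_of, Matrix.trace_fin_two, add_comm]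

theorem reflectXY_proj_basisKet (d : Fin 2) :
    reflectXY (proj (basisKet d)) = proj (basisKet (d + 1)) := by
  rw [reflectXY_eq]
  ext i j
  fin_cases d <;> fin_cases i <;> fin_cases j <;>
    simp [proj, basisKet, Matrix.vecMulVec_apply]

theorem reflectXY_proj_plusKet (θ : ZMod 8) :
    reflectXY (proj (plusKet θ)) = proj (plusKet θ) := by
  have hdiag : proj (plusKet θ) 0 0 = proj (plusKet θ) 1 1 := by
    have hphase : ZMod.stdAddChar θ * starRingEnd ℂ (ZMod.stdAddChar θ) = 1 := by
      rw [← AddChar.map_neg_eq_conj, ← AddChar.map_add_eq_mul, add_neg_cancel,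
        AddChar.map_zero_eq_one]
    calc proj (plusKet θ) 0 0 = (Real.sqrt 2 : ℂ)⁻¹ * (Real.sqrt 2 : ℂ)⁻¹ := by
          simp [proj, plusKet_eq_smul, Matrix.vecMulVec_apply]
      _ = (Real.sqrt 2 : ℂ)⁻¹ * (Real.sqrt 2 : ℂ)⁻¹ *
            (ZMod.stdAddChar θ * starRingEnd ℂ (ZMod.stdAddChar θ)) := by rw [hphase, mul_one]
      _ = proj (plusKet θ) 1 1 := by
          simp [proj, plusKet_eq_smul, Matrix.vecMulVec_apply]
          ring
  conv_rhs => rw [(proj (plusKet θ)).eta_fin_two]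
  rw [reflectXY_eq, hdiag]

end Qubit

section ProductState

variable {V : Type} [Fintype V]

/-- The tensor product of one-qubit kets. -/
def productKet (φ : V → Fin 2 → ℂ) (x : V → Fin 2) : ℂ := ∏ v, φ v (x v)

theorem tensor_proj (φ : V → Fin 2 → ℂ) :
    (tensor fun v => proj (φ v)) = Matrix.vecMulVec (productKet φ) (star (productKet φ)) := by
  ext x y
  simp [tensor, proj, Matrix.vecMulVec_apply, productKet, Finset.prod_mul_distrib]

variable [DecidableEq V]

theorem trace_tensor (A : V → Matrix (Fin 2) (Fin 2) ℂ) :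
    (tensor A).trace = ∏ v, (A v).trace :=
  (Fintype.prod_sum fun v k => A v k k).symm

theorem star_productKet_dotProduct (φ ψ : V → Fin 2 → ℂ) :
    star (productKet φ) ⬝ᵥ productKet ψ = ∏ v, star (φ v) ⬝ᵥ ψ v := by
  simp only [dotProduct, Fintype.prod_sum, Pi.star_apply, productKet, star_prod,
    Finset.prod_mul_distrib]

theorem productKet_update (φ : V → Fin 2 → ℂ) (x : V → Fin 2) (t : V) (k : Fin 2) :
    productKet φ (Function.update x t k) = φ t k * ∏ v ∈ Finset.univ.erase t, φ v (x v) := by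
  rw [productKet, ← Finset.mul_prod_erase _ _ (Finset.mem_univ t), Function.update_self]
  congr 1
  refine Finset.prod_congr rfl fun v hv => ?_
  rw [Function.update_of_ne (Finset.ne_of_mem_erase hv)]

end ProductState

section Entangle

variable {V : Type} [Fintype V]

open Classical in
/-- The sign which the controlled-`Z` gate on the two ends of `e` attaches to the computational
basis state `x`. -/
def czSign (x : V → Fin 2) (e : Sym2 V) : ℂ := if ∀ v ∈ e, x v = 1 then -1 else 1

open Classical in
/-- The sign which the controlled-`Z` gates over all edges of `G` attach to the computational basis
state `x`. -/
def edgeSign (G : SimpleGraph V) (x : V → Fin 2) : ℂ := ∏ e ∈ G.edgeFinset, czSign x e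

theorem entangle_eq_diagonal (G : SimpleGraph V) : entangle G = Matrix.diagonal (edgeSign G) :=
  rfl

theorem star_edgeSign_mul_self (G : SimpleGraph V) (x : V → Fin 2) :
    star (edgeSign G x) * edgeSign G x = 1 := by
  rw [edgeSign, star_prod, ← Finset.prod_mul_distrib]
  refine Finset.prod_eq_one fun e _ => ?_
  rw [czSign]
  split_ifs <;> simp

variable [DecidableEq V]

theorem entangle_mem_unitaryGroup (G : SimpleGraph V) :
    entangle G ∈ Matrix.unitaryGroup (V → Fin 2) ℂ := by
  rw [Matrix.mem_unitaryGroup_iff', entangle_eq_diagonal, Matrix.star_eq_conjTranspose,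
    Matrix.diagonal_conjTranspose, Matrix.diagonal_mul_diagonal]
  simp only [Pi.star_apply, star_edgeSign_mul_self, Matrix.diagonal_one]

theorem czSign_update_one (x : V → Fin 2) {t : V} (ht : x t = 0) (e : Sym2 V) :
    czSign (Function.update x t 1) e =
      czSign x e * if t ∈ e then czSign (Function.update x t 1) e else 1 := by
  by_cases hte : t ∈ e
  · have hx : czSign x e = 1 := if_neg fun h => zero_ne_one (ht.symm.trans (h t hte))
    rw [if_pos hte, hx, one_mul]
  · have hx : ∀ v ∈ e, Function.update x t 1 v = x v := fun v hv =>
      Function.update_of_ne (ne_of_mem_of_not_mem hv hte) _ _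
    have hiff : (∀ v ∈ e, Function.update x t 1 v = 1) ↔ ∀ v ∈ e, x v = 1 :=
      forall₂_congr fun v hv => by rw [hx v hv]
    rw [if_neg hte, mul_one, czSign, czSign]
    congr 1
    exact propext hiff

theorem prod_czSign_incident (G : SimpleGraph V) [DecidableRel G.Adj] (t : V) (x : V → Fin 2) :
    ∏ e ∈ G.edgeFinset with t ∈ e, czSign (Function.update x t 1) e =
      ∏ u ∈ G.neighborFinset t, if x u = 1 then -1 else 1 := by
  refine (Finset.prod_bij (fun u _ => s(t, u)) ?_ ?_ ?_ ?_).symm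
  · intro u hu
    simpa using hu
  · intro u _ v _ h
    exact Sym2.congr_right.1 h
  · intro e he
    rw [Finset.mem_filter, SimpleGraph.mem_edgeFinset] at he
    obtain ⟨u, rfl⟩ := Sym2.mem_iff_exists.1 he.2
    exact ⟨u, by simpa using he.1, rfl⟩
  · intro u hu
    have hne : u ≠ t := ((G.mem_neighborFinset t u).1 hu).ne'
    simp [czSign, hne]

theorem edgeSign_update_one (G : SimpleGraph V) {t : V} {x : V → Fin 2} (ht : x t = 0) :
    edgeSign G (Function.update x t 1) =
      edgeSign G x * (-1) ^ {u | G.Adj t u ∧ x u = 1}.ncard := by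
  classical
  have hcard : {u | G.Adj t u ∧ x u = 1}.ncard = #{u ∈ G.neighborFinset t | x u = 1} := by
    rw [← Set.ncard_coe_finset]
    congr 1
    ext u
    simp
  calc edgeSign G (Function.update x t 1)
      = ∏ e ∈ G.edgeFinset,
          czSign x e * if t ∈ e then czSign (Function.update x t 1) e else 1 := by
        rw [edgeSign]
        exact Finset.prod_congr (by congr!) fun e _ => czSign_update_one x ht e
    _ = (∏ e ∈ G.edgeFinset, czSign x e) *
          ∏ e ∈ G.edgeFinset with t ∈ e, czSign (Function.update x t 1) e := by
        rw [Finset.prod_mul_distrib, Finset.prod_filter]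
    _ = edgeSign G x * (-1) ^ {u | G.Adj t u ∧ x u = 1}.ncard := by
        rw [prod_czSign_incident, hcard, ← Finset.prod_const, Finset.prod_filter, edgeSign]

theorem star_productKet_dotProduct_entangle_mulVec_eq_zero (G : SimpleGraph V) (t : V)
    {m φ : V → Fin 2 → ℂ} {c : V → Fin 2} (hc : ∀ u, G.Adj t u → φ u = basisKet (c u))
    (ht : star (m t) ⬝ᵥ (pauliZ ^ {u | G.Adj t u ∧ c u = 1}.ncard *ᵥ φ t) = 0) :
    star (productKet m) ⬝ᵥ (entangle G *ᵥ productKet φ) = 0 := by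
  set k := {u | G.Adj t u ∧ c u = 1}.ncard
  have hm : star (m t 0) * φ t 0 + star (m t 1) * ((-1) ^ k * φ t 1) = 0 := by
    rwa [pauliZ_pow_mulVec, dotProduct, Fin.sum_univ_two] at ht
  have hterm (x : V → Fin 2) (i : Fin 2) :
      star (productKet m (Function.update x t i)) * productKet φ (Function.update x t i) =
        star (m t i) * φ t i * ∏ v ∈ Finset.univ.erase t, star (m v (x v)) * φ v (x v) := by
    rw [productKet_update, productKet_update, star_mul', star_prod, Finset.prod_mul_distrib]
    ring
  refine sum_eq_zero_of_add_update t fun x hx => ?_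
  have hterm_zero := hterm x 0
  rw [← hx, Function.update_eq_self, hx] at hterm_zero
  simp only [entangle_eq_diagonal, Matrix.mulVec_diagonal, Pi.star_apply, edgeSign_update_one G hx,
    mul_left_comm (star _), mul_assoc, hterm_zero, hterm x 1]
  by_cases hcx : ∀ u, G.Adj t u → x u = c u
  · have hset : {u | G.Adj t u ∧ x u = 1} = {u | G.Adj t u ∧ c u = 1} := by
      ext u
      exact and_congr_right fun hu => by rw [hcx u hu]
    rw [hset]
    linear_combination
      (edgeSign G x * ∏ v ∈ Finset.univ.erase t, star (m v (x v)) * φ v (x v)) * hm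
  · push Not at hcx
    obtain ⟨u, hu, hne⟩ := hcx
    have hzero : φ u (x u) = 0 := by rw [hc u hu, basisKet, Pi.single_eq_of_ne hne]
    rw [Finset.prod_eq_zero (Finset.mem_erase.2 ⟨hu.ne', Finset.mem_univ u⟩)
      (by rw [hzero, mul_zero])]
    simp only [mul_zero, add_zero]

end Entangle

variable {N : ℕ}

section AdaptiveMeasurement

theorem place_injective (C : Computation N) (σ : Layout N) : Function.Injective (place C σ) := by
  have hgraphHom : Function.Injective (graphHom C σ) := fun i j hij =>
    (Prod.ext_iff.1 (σ.symm.injective hij)).2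
  exact hgraphHom.sumMap (SimpleGraph.Hom.mapEdgeSet.injective _ hgraphHom)

theorem baseAngle_place (C : Computation N) (ν : Secret N) (b : Qubit N → Fin 2)
    (c : DottedVertex C.graph) :
    baseAngle C ν b (place C ν.layout c) =
      adaptedAngle C (fun c => b (place C ν.layout c) + ν.r (place C ν.layout c)) c :=
  (place_injective C ν.layout).extend_apply _ _ _

open Classical in
theorem baseAngle_of_not_isComputation (C : Computation N) (ν : Secret N) (b : Qubit N → Fin 2)
    {w : Qubit N} (hw : ¬ IsComputation C ν.layout w) :
    baseAngle C ν b w = if IsTrap ν.layout w then piTimes (ν.a w) else 0 :=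
  Function.extend_apply' _ _ _ hw

theorem adaptedAngle_congr (C : Computation N) {s s' : DottedVertex C.graph → Fin 2}
    {i : DottedVertex C.graph} (h : ∀ j, C.step j < C.step i → s j = s' j) :
    adaptedAngle C s i = adaptedAngle C s' i := by
  rw [adaptedAngle, adaptedAngle, C.xCorr_causal i s s' h, C.zCorr_causal i s s' h]

-- Among the computation qubits with different outcomes, one measured earliest has the same angle.
theorem exists_baseAngle_eq_of_ne (C : Computation N) (ν : Secret N) {b b' : Qubit N → Fin 2}
    (h : b ≠ b') : ∃ w, baseAngle C ν b w = baseAngle C ν b' w ∧ b w ≠ b' w := by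
  by_cases hout : ∃ w, ¬ IsComputation C ν.layout w ∧ b w ≠ b' w
  · obtain ⟨w, hw, hne⟩ := hout
    exact ⟨w, by simp only [baseAngle_of_not_isComputation C ν _ hw], hne⟩
  · push Not at hout
    obtain ⟨w, hw⟩ := Function.ne_iff.1 h
    obtain ⟨c, rfl⟩ : IsComputation C ν.layout w := not_imp_comm.1 (hout w) hw
    let S : Set (DottedVertex C.graph) :=
      {c | b (place C ν.layout c) ≠ b' (place C ν.layout c)}
    have hS : S.Nonempty := ⟨c, hw⟩
    refine ⟨place C ν.layout (Function.argminOn C.step S hS), ?_,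
      Function.argminOn_mem C.step S hS⟩
    rw [baseAngle_place, baseAngle_place]
    refine adaptedAngle_congr C fun j hj => ?_
    have hjS : j ∉ S := fun hmem => Function.not_lt_argminOn C.step S hmem hj
    rw [not_not.1 hjS]

theorem exists_measAngle_eq_of_ne (C : Computation N) (ν : Secret N) {b b' : Qubit N → Fin 2}
    (h : b ≠ b') : ∃ w, measAngle C ν b w = measAngle C ν b' w ∧ b w ≠ b' w := by
  obtain ⟨w, hangle, hne⟩ := exists_baseAngle_eq_of_ne C ν h
  exact ⟨w, by rw [measAngle, measAngle, hangle], hne⟩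

/-- The ket onto which the prover projects the qubit `w` when the outcomes `b` are reported. -/
def measKet (C : Computation N) (ν : Secret N) (b : Qubit N → Fin 2) (w : Qubit N) : Fin 2 → ℂ :=
  plusKet (measAngle C ν b w + piTimes (b w))

theorem exists_star_measKet_dotProduct_eq_zero (C : Computation N) (ν : Secret N)
    {b b' : Qubit N → Fin 2} (h : b ≠ b') :
    ∃ w, star (measKet C ν b w) ⬝ᵥ measKet C ν b' w = 0 := by
  obtain ⟨w, hangle, hne⟩ := exists_measAngle_eq_of_ne C ν h
  refine ⟨w, ?_⟩
  rw [measKet, measKet, hangle, piTimes_eq_add_four_of_ne hne, ← add_assoc]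
  exact star_plusKet_dotProduct_add_four _

/-- The graph along whose edges the prover entangles the qubits. -/
abbrev resourceGraph (N : ℕ) : SimpleGraph (Qubit N) := dotted (⊤ : SimpleGraph (Fin (3 * N)))

/-- The matrix whose rows are the bras of the measured product states. It is unitary although the
measurement angles depend on the outcomes. -/
def measMatrix (C : Computation N) (ν : Secret N) : Op (Qubit N) :=
  Matrix.of fun b => star (productKet (measKet C ν b))

theorem measMatrix_mem_unitaryGroup (C : Computation N) (ν : Secret N) :
    measMatrix C ν ∈ Matrix.unitaryGroup (Qubit N → Fin 2) ℂ := by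
  rw [Matrix.mem_unitaryGroup_iff]
  ext b b'
  have hentry : (measMatrix C ν * star (measMatrix C ν)) b b' =
      star (productKet (measKet C ν b)) ⬝ᵥ productKet (measKet C ν b') := by
    simp only [Matrix.mul_apply, measMatrix, Matrix.star_apply, Matrix.of_apply, Pi.star_apply,
      star_star, dotProduct]
  rw [hentry, star_productKet_dotProduct]
  by_cases hb : b = b'
  · rw [hb, Matrix.one_apply_eq]
    exact Finset.prod_eq_one fun w _ => star_plusKet_dotProduct_self _
  · obtain ⟨w, hw⟩ := exists_star_measKet_dotProduct_eq_zero C ν hb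
    rw [Matrix.one_apply_ne hb, Finset.prod_eq_zero (Finset.mem_univ w) hw]

/-- The unitary that takes the input state to the amplitudes of the outcomes. -/
def outcomeUnitary (C : Computation N) (ν : Secret N) : Op (Qubit N) :=
  measMatrix C ν * entangle (resourceGraph N)

theorem outcomeUnitary_mem_unitaryGroup (C : Computation N) (ν : Secret N) :
    outcomeUnitary C ν ∈ Matrix.unitaryGroup (Qubit N → Fin 2) ℂ :=
  mul_mem (measMatrix_mem_unitaryGroup C ν) (entangle_mem_unitaryGroup _)

theorem outcomeUnitary_mulVec_apply (C : Computation N) (ν : Secret N)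
    (ψ : (Qubit N → Fin 2) → ℂ) (b : Qubit N → Fin 2) :
    (outcomeUnitary C ν *ᵥ ψ) b =
      star (productKet (measKet C ν b)) ⬝ᵥ (entangle (resourceGraph N) *ᵥ ψ) := by
  rw [outcomeUnitary, ← Matrix.mulVec_mulVec]
  rfl

theorem outcomeProb_eq (C : Computation N) (ν : Secret N) (ρ : Op (Qubit N))
    (b : Qubit N → Fin 2) :
    outcomeProb C ν ρ b = ((outcomeUnitary C ν * ρ * (outcomeUnitary C ν)ᴴ) b b).re := by
  have hU : outcomeUnitary C ν * ρ * (outcomeUnitary C ν)ᴴ =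
      measMatrix C ν * (entangle (resourceGraph N) * ρ * (entangle (resourceGraph N))ᴴ) *
        (measMatrix C ν)ᴴ := by
    simp only [outcomeUnitary, Matrix.conjTranspose_mul, mul_assoc]
  have hrow : measMatrix C ν b = star (productKet (measKet C ν b)) := rfl
  rw [hU, mul_mul_conjTranspose_apply, hrow, star_star, ← trace_vecMulVec_star_mul, ← tensor_proj]
  rfl

theorem sum_outcomeProb (C : Computation N) (ν : Secret N) (ρ : Op (Qubit N)) :
    ∑ b, outcomeProb C ν ρ b = ρ.trace.re := by
  rw [← trace_mul_mul_conjTranspose (outcomeUnitary_mem_unitaryGroup C ν) ρ, Matrix.trace,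
    Complex.re_sum]
  exact Finset.sum_congr rfl fun b _ => outcomeProb_eq C ν ρ b

theorem outcomeProb_vecMulVec_eq_zero (C : Computation N) (ν : Secret N)
    {ψ : (Qubit N → Fin 2) → ℂ} {b : Qubit N → Fin 2}
    (h : star (productKet (measKet C ν b)) ⬝ᵥ (entangle (resourceGraph N) *ᵥ ψ) = 0) :
    outcomeProb C ν (Matrix.vecMulVec ψ (star ψ)) b = 0 := by
  rw [outcomeProb_eq, Matrix.mul_vecMulVec, Matrix.vecMulVec_mul, Matrix.vecMulVec_apply,
    outcomeUnitary_mulVec_apply, h, zero_mul, Complex.zero_re]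

theorem rejectProb_nonneg (C : Computation N) (ν : Secret N) {ρ : Op (Qubit N)}
    (hρ : ρ.PosSemidef) : 0 ≤ rejectProb C ν ρ := by
  refine Finset.sum_nonneg fun b _ => ?_
  split_ifs
  · exact le_rfl
  · rw [outcomeProb_eq]
    exact (Complex.le_def.1 (hρ.mul_mul_conjTranspose_same (outcomeUnitary C ν)).diag_nonneg).1

theorem abs_rejectProb_sub_le (C : Computation N) (ν : Secret N) {ρ τ : Op (Qubit N)}
    (h : ρ.trace = τ.trace) : |rejectProb C ν ρ - rejectProb C ν τ| ≤ traceDist ρ τ := by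
  classical
  let U := outcomeUnitary C ν
  have hdiff : rejectProb C ν ρ - rejectProb C ν τ =
      (∑ b with ¬ Accepts ν b, (U * (ρ - τ) * Uᴴ) b b).re := by
    simp only [U, rejectProb, outcomeProb_eq, Finset.sum_filter, Complex.re_sum,
      ← Finset.sum_sub_distrib, mul_sub, sub_mul, Matrix.sub_apply]
    refine Finset.sum_congr rfl fun b _ => ?_
    split_ifs <;> simp
  rw [hdiff]
  exact (Complex.abs_re_le_norm _).trans <|
    norm_sum_diag_conj_le (outcomeUnitary_mem_unitaryGroup C ν)
      (by rw [Matrix.trace_sub, h, sub_self]) _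

end AdaptiveMeasurement

section ReflectedInput

theorem layout_eq_zero_of_isComputation_inl {C : Computation N} {σ : Layout N}
    {v : Fin (3 * N)} (h : IsComputation C σ (Sum.inl v)) : (σ v).1 = 0 := by
  obtain ⟨c | c, hc⟩ := h
  · obtain rfl := Sum.inl_injective hc
    simp [graphHom]
  · cases hc

theorem layout_eq_zero_of_isComputation_inr {C : Computation N} {σ : Layout N}
    {e : (⊤ : SimpleGraph (Fin (3 * N))).edgeSet} (h : IsComputation C σ (Sum.inr e))
    {v : Fin (3 * N)} (hv : v ∈ e.1) : (σ v).1 = 0 := by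
  obtain ⟨c | ⟨f, hf⟩, hc⟩ := h
  · cases hc
  · obtain rfl := Sum.inr_injective hc
    obtain ⟨i, -, rfl⟩ := Sym2.mem_map.1 (show v ∈ Sym2.map (graphHom C σ) f from hv)
    simp [graphHom]

theorem not_isComputation_of_isTrap (C : Computation N) {σ : Layout N} {t : Qubit N}
    (ht : IsTrap σ t) : ¬ IsComputation C σ t := by
  intro hcomp
  rcases t with v | e
  · exact absurd (ht.symm.trans (layout_eq_zero_of_isComputation_inl hcomp)) (by decide)
  · have hmem := e.1.out_fst_mem
    exact absurd ((ht _ hmem).symm.trans (layout_eq_zero_of_isComputation_inr hcomp hmem))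
      (by decide)

theorem isDummy_of_adj_isTrap (C : Computation N) {σ : Layout N} {t u : Qubit N}
    (ht : IsTrap σ t) (h : (resourceGraph N).Adj t u) : IsDummy C σ u := by
  rcases t with v | e <;> rcases u with w | f
  · exact h.elim
  · exact ⟨fun hf => absurd (ht.symm.trans (layout_eq_zero_of_isComputation_inr hf h)) (by decide),
      fun hf => absurd (ht.symm.trans (hf v h)) (by decide)⟩
  · exact ⟨fun hw =>
        absurd ((ht w h).symm.trans (layout_eq_zero_of_isComputation_inl hw)) (by decide),
      fun hw => absurd ((ht w h).symm.trans hw) (by decide)⟩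
  · exact h.elim

theorem dummyNeighbors_of_isTrap (C : Computation N) {σ : Layout N} {t : Qubit N}
    (ht : IsTrap σ t) : dummyNeighbors C σ t = (resourceGraph N).neighborSet t :=
  Set.ext fun _ => and_iff_left_of_imp (isDummy_of_adj_isTrap C ht)

open Classical in
/-- The ket of a qubit in the reflected input: the dummies are flipped. -/
def flippedKet (C : Computation N) (ν : Secret N) (w : Qubit N) : Fin 2 → ℂ :=
  if IsDummy C ν.layout w then basisKet (ν.d w + 1) else plusKet (ν.θ w)

theorem reflectXY_proj_idealKet (C : Computation N) (ν : Secret N) (w : Qubit N) :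
    reflectXY (proj (idealKet C ν w)) = proj (flippedKet C ν w) := by
  rw [idealKet, flippedKet]
  split_ifs
  · exact reflectXY_proj_basisKet _
  · exact reflectXY_proj_plusKet _

theorem reflectedInput_eq_vecMulVec (C : Computation N) (ν : Secret N) :
    reflectedInput C ν = Matrix.vecMulVec (productKet (flippedKet C ν))
      (star (productKet (flippedKet C ν))) := by
  rw [← tensor_proj, reflectedInput]
  simp only [reflectXY_proj_idealKet]

theorem trace_reflectedInput (C : Computation N) (ν : Secret N) :
    (reflectedInput C ν).trace = 1 := by
  rw [reflectedInput, trace_tensor]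
  refine Finset.prod_eq_one fun w _ => ?_
  rw [trace_reflectXY, trace_proj, idealKet]
  split_ifs
  · exact star_basisKet_dotProduct_self _
  · exact star_plusKet_dotProduct_self _

theorem oneNeighbors_add_ncard_flipped (C : Computation N) (ν : Secret N) {t : Qubit N}
    (ht : IsTrap ν.layout t) :
    oneNeighbors C ν t + {u | (resourceGraph N).Adj t u ∧ ν.d u + 1 = 1}.ncard =
      (dummyNeighbors C ν.layout t).ncard := by
  have hbit : ∀ d : Fin 2, d + 1 = 1 ↔ d ≠ 1 := by decide
  have hset : {u | (resourceGraph N).Adj t u ∧ ν.d u + 1 = 1} =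
      dummyNeighbors C ν.layout t \ {u | ν.d u = 1} := by
    simp only [dummyNeighbors_of_isTrap C ht, hbit]
    rfl
  rw [hset]
  exact Set.ncard_inter_add_ncard_sdiff_eq_ncard _ _

theorem measAngle_add_piTimes_of_accepts (C : Computation N) (ν : Secret N)
    {b : Qubit N → Fin 2} (hb : Accepts ν b) {t : Qubit N} (ht : IsTrap ν.layout t) :
    measAngle C ν b t + piTimes (b t) = ν.θ t + 4 * (oneNeighbors C ν t : ZMod 8) := by
  have hbits : ∀ a r : Fin 2, piTimes a + piTimes r + piTimes (r + a) = 0 := by decide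
  rw [measAngle, baseAngle_of_not_isComputation C ν b (not_isComputation_of_isTrap C ht),
    if_pos ht, hb t ht]
  linear_combination hbits (ν.a t) (ν.r t)

theorem four_mul_natCast_of_odd_add {k l : ℕ} (h : Odd (k + l)) :
    4 * (k : ZMod 8) = 4 * l + 4 := by
  obtain ⟨m, hm⟩ := h
  have hcast : (k + l : ZMod 8) = 2 * m + 1 := mod_cast congrArg Nat.cast hm
  have hmod : (8 : ZMod 8) = 0 := rfl
  linear_combination 4 * hcast + (m - l) * hmod

/-- On the reflected input a trap with an odd number of dummy neighbours is measured in the basis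
of its own state, with the unexpected outcome. -/
theorem outcomeProb_reflectedInput_eq_zero (C : Computation N) (ν : Secret N)
    (hodd : HasOddTrap C ν.layout) {b : Qubit N → Fin 2} (hb : Accepts ν b) :
    outcomeProb C ν (reflectedInput C ν) b = 0 := by
  obtain ⟨t, ht, hodd⟩ := hodd
  have hneighbor : ∀ u, (resourceGraph N).Adj t u → flippedKet C ν u = basisKet (ν.d u + 1) :=
    fun u hu => if_pos (isDummy_of_adj_isTrap C ht hu)
  have htrap : flippedKet C ν t = plusKet (ν.θ t) := if_neg fun h => h.2 ht
  rw [reflectedInput_eq_vecMulVec]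
  refine outcomeProb_vecMulVec_eq_zero C ν
    (star_productKet_dotProduct_entangle_mulVec_eq_zero _ t hneighbor ?_)
  rw [← oneNeighbors_add_ncard_flipped C ν ht, add_comm] at hodd
  rw [htrap, pauliZ_pow_mulVec_plusKet, four_mul_natCast_of_odd_add hodd, ← add_assoc, measKet,
    measAngle_add_piTimes_of_accepts C ν hb ht]
  exact star_plusKet_dotProduct_add_four _

theorem rejectProb_reflectedInput (C : Computation N) (ν : Secret N)
    (hodd : HasOddTrap C ν.layout) : rejectProb C ν (reflectedInput C ν) = 1 :=
  calc rejectProb C ν (reflectedInput C ν)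
      = ∑ b, outcomeProb C ν (reflectedInput C ν) b := by
        refine Finset.sum_congr rfl fun b _ => ?_
        split_ifs with hb
        · exact (outcomeProb_reflectedInput_eq_zero C ν hodd hb).symm
        · rfl
    _ = 1 := by rw [sum_outcomeProb, trace_reflectedInput, Complex.one_re]

end ReflectedInput

section ProtocolRejection

theorem one_sub_traceDist_le_rejectProb (C : Computation N) (ν : Secret N)
    (hodd : HasOddTrap C ν.layout) {ρ : Op (Qubit N)} (hρ : ρ.trace = 1) :
    1 - traceDist ρ (reflectedInput C ν) ≤ rejectProb C ν ρ := by
  have hdiff := abs_rejectProb_sub_le C ν (hρ.trans (trace_reflectedInput C ν).symm)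
  rw [rejectProb_reflectedInput C ν hodd] at hdiff
  linarith [(abs_le.1 hdiff).1]

instance (N : ℕ) : Nonempty (Secret N) :=
  ⟨⟨finProdFinEquiv.symm, 0, 0, 0, 0⟩⟩

theorem le_protocolRejectProb (C : Computation N) {ρ : Secret N → Op (Qubit N)} {p : ℝ}
    (h : ∀ ν, p ≤ rejectProb C ν (ρ ν)) : p ≤ protocolRejectProb C ρ := by
  rw [protocolRejectProb, le_div_iff₀ (Nat.cast_pos.2 Fintype.card_pos), mul_comm,
    ← nsmul_eq_mul]
  exact Finset.card_nsmul_le_sum _ _ _ fun ν _ => h ν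

theorem one_sub_sqrt_le {p ε : ℝ} (hp : 0 ≤ p) (h : 1 - ε ≤ p) : 1 - Real.sqrt ε ≤ p := by
  rcases le_total 1 ε with hε | hε
  · linarith [Real.one_le_sqrt.2 hε]
  · rcases le_total ε 0 with hneg | hpos
    · linarith [Real.sqrt_nonneg ε]
    · linarith [Real.le_sqrt_of_sq_le (by nlinarith : ε ^ 2 ≤ ε)]

end ProtocolRejection

end FK

end

theorem lemmal_general {N : ℕ} (C : FK.Computation N)
    (hodd : ∀ σ : FK.Layout N, FK.HasOddTrap C σ) :
    (∀ ν : FK.Secret N, FK.rejectProb C ν (FK.reflectedInput C ν) = 1) ∧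
    ∀ (ε : ℝ) (ρ : FK.Secret N → FK.Op (FK.Qubit N)),
      (∀ ν, (ρ ν).trace = 1) →
      (∀ ν, FK.traceDist (ρ ν) (FK.reflectedInput C ν) ≤ ε) →
      (∀ ν, 1 - ε ≤ FK.rejectProb C ν (ρ ν)) ∧ 1 - ε ≤ FK.protocolRejectProb C ρ := by
  refine ⟨fun ν => FK.rejectProb_reflectedInput C ν (hodd _), fun ε ρ htrace hdist => ?_⟩
  have hreject (ν : FK.Secret N) : 1 - ε ≤ FK.rejectProb C ν (ρ ν) :=
    (sub_le_sub_left (hdist ν) 1).trans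
      (FK.one_sub_traceDist_le_rejectProb C ν (hodd _) (htrace ν))
  exact ⟨hreject, FK.le_protocolRejectProb C hreject⟩

theorem lemmal :
    ∃ K : ℝ, 0 < K ∧ ∀ (N : ℕ) (C : FK.Computation N),
      (∀ σ : FK.Layout N, FK.HasOddTrap C σ) →
      (∀ ν : FK.Secret N, FK.rejectProb C ν (FK.reflectedInput C ν) = 1) ∧
      ∀ (ε : ℝ) (ρ : FK.Secret N → FK.Op (FK.Qubit N)),
        (∀ ν, FK.IsDensity (ρ ν)) →
        (∀ ν, FK.traceDist (ρ ν) (FK.reflectedInput C ν) ≤ ε) →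
        (∀ ν, 1 - K * Real.sqrt ε ≤ FK.rejectProb C ν (ρ ν)) ∧
        1 - K * Real.sqrt ε ≤ FK.protocolRejectProb C ρ := by
  refine ⟨1, one_pos, fun N C hodd => ?_⟩
  obtain ⟨hreflected, hlinear⟩ := lemmal_general C hodd
  refine ⟨hreflected, fun ε ρ hρ hdist => ?_⟩
  have hsqrt (ν : FK.Secret N) : 1 - 1 * Real.sqrt ε ≤ FK.rejectProb C ν (ρ ν) := by
    rw [one_mul]
    exact FK.one_sub_sqrt_le (FK.rejectProb_nonneg C ν (hρ ν).1)
      ((hlinear ε ρ (fun ν => (hρ ν).2) hdist).1 ν)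
  exact ⟨hsqrt, FK.le_protocolRejectProb C hsqrt⟩
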